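/- Assume the Continuum Hypothesis $2^{\aleph_0}=\aleph_1$ and that there is a Suslin line (a linearly ordered set whose order topology satisfies the countable chain condition but is not separable). Then there is an uncountable almost disjoint family $\mathcal A$ of subsets of $\mathbb N$ which is anti-Luzin and has no uncountable subfamily that is a hidden weak tree family. Here: - A family of sets is *almost disjoint* if its members are infinite and any two distinct members have finite intersection. - $\mathcal A$ is *anti-Luzin* if for every $\mathcal B\subseteq\mathcal A$ with $|\mathcal B|=\aleph_1$ there are $\mathcal C,\mathcal D\subseteq\mathcal B$ with $|\mathcal C|=|\mathcal D|=\aleph_1$ such that $\bigcup\mathcal C\cap\bigcup\mathcal D$ is finite. - A *tree ordering* of a set $T$ is a strict partial order on $T$ such that the set of predecessors of each element is well-ordered; a *branch* is a maximal chain. - An uncountable almost disjoint family $\mathcal B$ is a *weak tree family* if there are a tree ordering $\prec$ of $\bigcup\mathcal B$ and a one-to-one function $\varphi$ from $\mathcal B$ to the set of branches of $(\bigcup\mathcal B,\prec)$ such that any two distinct branches in the range of $\varphi$ have finite intersection and $b\setminus\varphi(b)$ is finite for every $b\in\mathcal B$. - A family $\mathcal B$ is a *hidden weak tree family* if for some set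 $T$ the family $\{b\cap T: b\in\mathcal B\}$ is a weak tree family. -/

import Mathlib

open scoped Cardinal

/-- A Suslin line: a linear order whose order topology satisfies the countable chain condition
(every family of pairwise disjoint nonempty open sets is countable) but is not separable. -/
structure IsSuslinLine (L : Type*) [LinearOrder L] [TopologicalSpace L] [OrderTopology L] :
    Prop where
  ccc : ∀ S : Set (Set L), (∀ U ∈ S, IsOpen U ∧ U.Nonempty) →
    S.Pairwise (fun U V => Disjoint U V) → S.Countable
  not_separable : ¬ TopologicalSpace.SeparableSpace L

/-- An almost disjoint family: a collection of infinite sets with finite pairwise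
intersections. -/
def IsAlmostDisjointFamily {W : Type*} (A : Set (Set W)) : Prop :=
  (∀ a ∈ A, a.Infinite) ∧ A.Pairwise (fun a b => (a ∩ b).Finite)

/-- `A` is anti-Luzin: every subfamily of size `ℵ₁` has two subfamilies of size `ℵ₁` whose unions
have finite intersection. -/
def IsAntiLuzin {W : Type*} (A : Set (Set W)) : Prop :=
  ∀ B ⊆ A, #B = ℵ₁ →
    ∃ C ⊆ B, ∃ D ⊆ B, #C = ℵ₁ ∧ #D = ℵ₁ ∧ (⋃₀ C ∩ ⋃₀ D).Finite

/-- `(T, r)` is a (set-theoretic) tree: `r` is a strict partial order on `T` and the set of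
predecessors in `T` of each element of `T` is well-ordered by `r`. Only the restriction of `r` to
`T` matters. -/
structure IsTreeOrder {W : Type*} (T : Set W) (r : W → W → Prop) : Prop where
  irrefl : ∀ x ∈ T, ¬ r x x
  trans : ∀ x ∈ T, ∀ y ∈ T, ∀ z ∈ T, r x y → r y z → r x z
  pred_total : ∀ x ∈ T, ∀ y ∈ T, ∀ z ∈ T, r y x → r z x → r y z ∨ y = z ∨ r z y
  pred_wellFounded : ∀ x ∈ T, {y | y ∈ T ∧ r y x}.WellFoundedOn r

/-- A branch of `(T, r)`: a maximal chain. -/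
def IsTreeBranch {W : Type*} (T : Set W) (r : W → W → Prop) (b : Set W) : Prop :=
  Maximal (fun c : Set W => c ⊆ T ∧ IsChain r c) b

/-- `A` is a weak tree family: an uncountable almost disjoint family for which there are a tree
ordering `r` of `⋃ A` and a one-to-one map `φ` from `A` to the branches of `(⋃ A, r)`, with range
pairwise disjoint (mod finite), such that each `a ∈ A` is contained, mod finite, in `φ a`. -/
def IsWeakTreeFamily {W : Type*} (A : Set (Set W)) : Prop :=
  ¬ A.Countable ∧ IsAlmostDisjointFamily A ∧
    ∃ r : W → W → Prop, IsTreeOrder (⋃₀ A) r ∧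
      ∃ φ : Set W → Set W, (∀ a ∈ A, IsTreeBranch (⋃₀ A) r (φ a)) ∧ Set.InjOn φ A ∧
        (φ '' A).Pairwise (fun b c => (b ∩ c).Finite) ∧ ∀ a ∈ A, (a \ φ a).Finite

/-- `A` is a hidden weak tree family: for some `T`, the traces `a ∩ T`, `a ∈ A`, form a weak tree
family. -/
def IsHiddenWeakTreeFamily {W : Type*} (A : Set (Set W)) : Prop :=
  ∃ T : Set W, IsWeakTreeFamily ((fun a => a ∩ T) '' A)

/-!
Restricting a coherent sequence of finite-to-one functions `e i : [0, i) → ℕ`, `i < ω₁`, to initial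
segments gives an Aronszajn tree. To its nodes one attaches infinite sets, almost decreasing along
the tree and almost disjoint at incompatible nodes, and the family consists of the sets at the nodes
`e i`. An uncountable set of nodes splits at some level into two uncountable cones, and almost
disjointness of the two sets there gives the anti-Luzin property. Under CH all tree orders on
subsets of `ℕ` are listed in type `ω₁`, and the sets of level `w` are chosen to be homogeneous for
the `w`-th one. Among the branches of a weak tree family at most one meets a given chain in an
infinite set, and none meets an antichain in an infinite set. So each of the countably many sets of
level `w` almost contains at most one member of the family, while all but countably many members lie
almost inside one of them.
-/

section Construction

open Set
open scoped Function

section AlmostInclusion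

variable {α : Type*} {s s' t t' u : Set α}

theorem finite_inter_of_finite_sdiff (hs : (s \ s').Finite) (ht : (t \ t').Finite)
    (h : (s' ∩ t').Finite) : (s ∩ t).Finite :=
  ((hs.union ht).union h).subset fun y hy => by
    by_cases hys : y ∈ s' <;> by_cases hyt : y ∈ t' <;> simp_all

theorem infinite_inter_of_finite_sdiff (hs : s.Infinite) (ht : (s \ t).Finite)
    (hu : (s \ u).Finite) : (t ∩ u).Infinite := fun h =>
  hs (inter_self s ▸ finite_inter_of_finite_sdiff ht hu h)

theorem infinite_sInter_of_finite_sdiff {F : Set (Set α)} (hs : s.Infinite) (hF : F.Finite)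
    (h : ∀ t ∈ F, (s \ t).Finite) : (⋂₀ F).Infinite := by
  refine (hs.sdiff (hF.biUnion h)).mono fun y hy t ht => ?_
  by_contra hyt
  exact hy.2 (mem_biUnion ht ⟨hy.1, hyt⟩)

end AlmostInclusion

section Countability

variable {ι α β : Type*}

theorem exists_not_countable_fiber {J : Set ι} (hJ : ¬ J.Countable) (g : ι → β)
    (hg : (g '' J).Countable) : ∃ k ∈ J, ¬ {l ∈ J | g l = g k}.Countable := by
  by_contra! h
  have hfiber : ∀ y ∈ g '' J, {l ∈ J | g l = y}.Countable := by
    rintro _ ⟨k, hk, rfl⟩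
    exact h k hk
  refine hJ ((hg.biUnion hfiber).mono fun k hk => ?_)
  exact mem_iUnion₂.2 ⟨g k, mem_image_of_mem g hk, hk, rfl⟩

theorem not_countable_inter_Ici [LinearOrder ι] {w : ι} (hw : (Iio w).Countable) {J : Set ι}
    (hJ : ¬ J.Countable) : ¬ (J ∩ Ici w).Countable := fun h =>
  hJ ((h.union hw).mono fun k hk => (lt_or_ge k w).elim Or.inr fun hwk => Or.inl ⟨hk, hwk⟩)

theorem countable_setOf_finite_ne [Countable ι] [Countable β] (g : ι → β) :
    {f : ι → β | {i | f i ≠ g i}.Finite}.Countable := by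
  let graph : (ι → β) → Set (ι × β) := fun f => (fun i => (i, f i)) '' {i | f i ≠ g i}
  have hgraph : ∀ {f f' i}, graph f = graph f' → f i ≠ g i → f' i = f i := by
    intro f f' i hff' hi
    obtain ⟨j, -, hj⟩ : (i, f i) ∈ graph f' := hff' ▸ mem_image_of_mem _ hi
    obtain ⟨rfl, hj⟩ := Prod.mk.inj hj
    exact hj
  refine MapsTo.countable_of_injOn (f := graph) (fun f hf => hf.image _) ?_
    Countable.ofPred_finite
  intro f _ f' _ hff'
  ext i
  by_cases hi : f i = g i
  · by_cases hi' : f' i = g i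
    · rw [hi, hi']
    · exact hgraph hff'.symm hi'
  · exact (hgraph hff' hi).symm

theorem exists_uncountable_subset_iUnion_finite_sdiff [Countable α] {a y : ι → Set α} {J : Set ι}
    (hJ : ¬ J.Countable) (hy : (y '' J).Countable) (hay : ∀ k ∈ J, (a k \ y k).Finite) :
    ∃ i ∈ J, ∃ K ⊆ J, ¬ K.Countable ∧ ((⋃ k ∈ K, a k) \ y i).Finite := by
  obtain ⟨i, hi, hK⟩ := exists_not_countable_fiber hJ (fun k => (y k, a k \ y k))
    ((hy.prod Countable.ofPred_finite).mono (by
      rintro _ ⟨k, hk, rfl⟩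
      exact ⟨mem_image_of_mem y hk, hay k hk⟩))
  refine ⟨i, hi, _, sep_subset _ _, hK, (hay i hi).subset ?_⟩
  rintro z ⟨hz, hzi⟩
  obtain ⟨k, ⟨-, hk⟩, hzk⟩ := mem_iUnion₂.1 hz
  obtain ⟨hY, hF⟩ := Prod.mk.inj hk
  exact hF ▸ ⟨hzk, hY ▸ hzi⟩

theorem isAntiLuzin_range_of_injective {a : ι → Set α} (ha : Function.Injective a)
    (h : ∀ J : Set ι, ¬ J.Countable → ∃ K ⊆ J, ∃ L ⊆ J, ¬ K.Countable ∧ ¬ L.Countable ∧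
      ((⋃ k ∈ K, a k) ∩ ⋃ l ∈ L, a l).Finite) :
    IsAntiLuzin (range a) := by
  intro B hB hcard
  obtain ⟨J, rfl⟩ := subset_range_iff_exists_image_eq.1 hB
  have mk_image : ∀ K ⊆ J, ¬ K.Countable → #(a '' K) = ℵ₁ := by
    intro K hKJ hK
    refine le_antisymm (hcard ▸ Cardinal.mk_le_mk_of_subset (image_mono hKJ)) ?_
    rw [Cardinal.aleph_one_le_iff, ← not_le, Cardinal.le_aleph0_iff_set_countable]
    exact fun h => hK ((mapsTo_image a K).countable_of_injOn ha.injOn h)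
  have hJ : ¬ J.Countable := fun hJ => Cardinal.aleph0_lt_aleph_one.not_ge
    (hcard ▸ Cardinal.le_aleph0_iff_set_countable.2 (hJ.image a))
  obtain ⟨K, hKJ, L, hLJ, hK, hL, hfin⟩ := h J hJ
  refine ⟨a '' K, image_mono hKJ, a '' L, image_mono hLJ, mk_image K hKJ hK, mk_image L hLJ hL, ?_⟩
  rwa [sUnion_image, sUnion_image]

end Countability

section CoherentSequence

variable {W : Type*} [LinearOrder W]

/-- A coherent sequence of finite-to-one functions `e a` on the initial segments of `W`. The
normalization `e a a = 0 < e a b` makes the node `e a` incompatible with `e b` for `b < a`; the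
values `e a b` with `a < b` are irrelevant. -/
structure IsCoherentSequence (e : W → W → ℕ) : Prop where
  self : ∀ a, e a a = 0
  pos : ∀ a, ∀ b < a, 0 < e a b
  finite_le : ∀ a n, {b | b ≤ a ∧ e a b ≤ n}.Finite
  coherent : ∀ a, ∀ b < a, {c | c ≤ b ∧ e a c ≠ e b c}.Finite

open Classical in
/-- The first step of the minimal walk from `a` down to `b < a` along the enumerations
`c a : Iio a → ℕ`: the element of `[b, a)` that `c a` lists first. It is `b` if `[b, a)` is
empty. -/
noncomputable def walkStep (c : W → W → ℕ) (a b : W) : W :=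
  if h : (Ico b a).Nonempty then Function.argminOn (c a) (Ico b a) h else b

theorem walkStep_mem_Ico (c : W → W → ℕ) {a b : W} (h : b < a) : walkStep c a b ∈ Ico b a := by
  rw [walkStep, dif_pos (nonempty_Ico.2 h)]
  exact Function.argminOn_mem _ _ _

theorem apply_walkStep_le (c : W → W → ℕ) {a b d : W} (hd : d ∈ Ico b a) :
    c a (walkStep c a b) ≤ c a d := by
  rw [walkStep, dif_pos ⟨d, hd⟩]
  exact Function.argminOn_le _ _ hd

variable {c : W → W → ℕ}

theorem finite_setOf_lt_and_apply_le (hc : ∀ a, InjOn (c a) (Iio a)) (a : W) (n : ℕ) :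
    {d | d < a ∧ c a d ≤ n}.Finite :=
  Finite.of_injOn (fun _ hd => hd.2) ((hc a).mono fun _ hd => hd.1) (finite_Iic n)

/-- Todorcevic's function `ρ₁`: the maximal weight of a step in the minimal walk from `a` down to
`b`, shifted by one so that it is positive for `b < a`. It is `0` if `a ≤ b`. -/
noncomputable def maxWeight [WellFoundedLT W] (c : W → W → ℕ) (a b : W) : ℕ :=
  if h : b < a then max (c a (walkStep c a b) + 1) (maxWeight c (walkStep c a b) b) else 0
termination_by wellFounded_lt.wrap a
decreasing_by exact (walkStep_mem_Ico c h).2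

variable [WellFoundedLT W]

theorem maxWeight_of_lt {a b : W} (h : b < a) :
    maxWeight c a b = max (c a (walkStep c a b) + 1) (maxWeight c (walkStep c a b) b) := by
  rw [maxWeight, dif_pos h]

theorem maxWeight_self (a : W) : maxWeight c a a = 0 := by
  rw [maxWeight, dif_neg (lt_irrefl a)]

theorem finite_setOf_maxWeight_le (hc : ∀ a, InjOn (c a) (Iio a)) (a : W) (n : ℕ) :
    {b | b ≤ a ∧ maxWeight c a b ≤ n}.Finite := by
  induction a using WellFoundedLT.induction with
  | ind a ih =>
    refine ((finite_singleton a).union ((finite_setOf_lt_and_apply_le hc a n).biUnion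
      fun d hd => ih d hd.1)).subset fun b ⟨hba, hb⟩ => ?_
    rcases hba.eq_or_lt with rfl | hba
    · exact Or.inl rfl
    · rw [maxWeight_of_lt hba, max_le_iff] at hb
      obtain ⟨hle, hlt⟩ := walkStep_mem_Ico c hba
      exact Or.inr (mem_biUnion ⟨hlt, (Nat.le_succ _).trans hb.1⟩ ⟨hle, hb.2⟩)

theorem finite_setOf_maxWeight_ne (hc : ∀ a, InjOn (c a) (Iio a)) {a b : W} (hba : b < a) :
    {x | x ≤ b ∧ maxWeight c a x ≠ maxWeight c b x}.Finite := by
  induction a using WellFoundedLT.induction generalizing b with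
  | ind a ih =>
    have below : ∀ d < a, {x | x ≤ d ∧ x ≤ b ∧ maxWeight c d x ≠ maxWeight c b x}.Finite := by
      intro d hda
      rcases lt_trichotomy d b with hdb | rfl | hbd
      · exact (ih b hba hdb).subset fun x hx => ⟨hx.1, hx.2.2.symm⟩
      · exact finite_empty.subset fun x hx => hx.2.2 rfl
      · exact (ih d hda hbd).subset fun x hx => hx.2
    -- The first step from `a` towards any `x ≤ b` is one of the finitely many `d` which `c a`
    -- lists no later than `b`.
    refine ((finite_setOf_lt_and_apply_le hc a (c a b)).biUnion fun d hd =>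
      (finite_setOf_maxWeight_le hc d (c a b + 1)).union (below d hd.1)).subset
        fun x ⟨hxb, hne⟩ => ?_
    have hxa := hxb.trans_lt hba
    obtain ⟨hxd, hda⟩ := walkStep_mem_Ico c hxa
    have hd : c a (walkStep c a x) ≤ c a b := apply_walkStep_le c ⟨hxb, hba⟩
    refine mem_biUnion ⟨hda, hd⟩ ?_
    rcases le_or_gt (maxWeight c (walkStep c a x) x) (c a b + 1) with hle | hgt
    · exact Or.inl ⟨hxd, hle⟩
    · rw [maxWeight_of_lt hxa, max_eq_right (by omega)] at hne
      exact Or.inr ⟨hxd, hxb, hne⟩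

theorem isCoherentSequence_maxWeight (hc : ∀ a, InjOn (c a) (Iio a)) :
    IsCoherentSequence (maxWeight c) where
  self := maxWeight_self
  pos a b hba := by
    rw [maxWeight_of_lt hba]
    exact lt_max_of_lt_left (Nat.succ_pos _)
  finite_le := finite_setOf_maxWeight_le hc
  coherent _ _ := finite_setOf_maxWeight_ne hc

theorem exists_isCoherentSequence (hW : ∀ w : W, (Iio w).Countable) :
    ∃ e : W → W → ℕ, IsCoherentSequence e := by
  choose c hc using fun w => countable_iff_exists_injOn.1 (hW w)
  exact ⟨maxWeight c, isCoherentSequence_maxWeight hc⟩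

end CoherentSequence

namespace IsCoherentSequence

variable {W : Type*} [LinearOrder W] {e : W → W → ℕ}

theorem countable_restrict (he : IsCoherentSequence e) (hW : ∀ w : W, (Iio w).Countable) (w : W) :
    ((fun i => (Iic w).domRestrict (e i)) '' Ici w).Countable := by
  have : Countable (Iic w) := by
    rw [← Iio_insert]
    exact ((hW w).insert w).to_subtype
  refine (countable_setOf_finite_ne ((Iic w).domRestrict (e w))).mono ?_
  rintro _ ⟨i, hi, rfl⟩
  rcases (mem_Ici.1 hi).eq_or_lt with rfl | hwi
  · simp
  · exact Finite.of_finite_image ((he.coherent i w hwi).subset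
      (image_subset_iff.2 fun v hv => ⟨v.2, hv⟩)) Subtype.val_injective.injOn

theorem exists_not_countable_ne (he : IsCoherentSequence e)
    (hW : ∀ w : W, (Iio w).Countable) {J : Set W} (hJ : ¬ J.Countable) (f : W → ℕ) :
    ∃ w, ¬ {k ∈ J | e k w ≠ f w}.Countable := by
  by_contra! h
  obtain ⟨u, -, hu⟩ := exists_not_countable_fiber hJ f (to_countable _)
  obtain ⟨Q, hQu, hQ, hQinf⟩ := Infinite.exists_subset_countable_infinite fun hfin =>
    hu hfin.countable
  obtain ⟨k, -, hk⟩ : ∃ k ∈ J, ∀ w ∈ Q, w ≤ k ∧ e k w = f w := by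
    by_contra! hcover
    refine hJ ((hQ.biUnion fun w _ => (hW w).union (h w)).mono fun k hkJ => ?_)
    obtain ⟨w, hwQ, hw⟩ := hcover k hkJ
    exact mem_iUnion₂.2 ⟨w, hwQ,
      (lt_or_ge k w).imp_right fun hwk => ⟨hkJ, hw hwk⟩⟩
  refine hQinf ((he.finite_le k (f u)).subset fun w hw => ?_)
  exact ⟨(hk w hw).1, ((hk w hw).2.trans (hQu hw).2).le⟩

theorem exists_splitting_level (he : IsCoherentSequence e)
    (hW : ∀ w : W, (Iio w).Countable) {J : Set W} (hJ : ¬ J.Countable) :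
    ∃ w m n, m ≠ n ∧ ¬ {k ∈ J ∩ Ici w | e k w = m}.Countable ∧
      ¬ {k ∈ J ∩ Ici w | e k w = n}.Countable := by
  choose i _ hi using fun w =>
    exists_not_countable_fiber (not_countable_inter_Ici (hW w) hJ) (fun k => e k w) (to_countable _)
  obtain ⟨w, hw⟩ := he.exists_not_countable_ne hW hJ fun w => e (i w) w
  obtain ⟨j, hj, hjw⟩ := exists_not_countable_fiber (not_countable_inter_Ici (hW w) hw)
    (fun k => e k w) (to_countable _)
  refine ⟨w, e j w, e (i w) w, hj.1.2, fun h => hjw (h.mono ?_), hi w⟩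
  exact fun k hk => ⟨⟨hk.1.1.1, hk.1.2⟩, hk.2⟩

end IsCoherentSequence

section Splitting

variable {α : Type*}

/-- The strong finite intersection property. The empty subfamily has intersection `univ`, so the
property includes that `α` is infinite. -/
def HasStrongFIP (S : Set (Set α)) : Prop :=
  ∀ F ⊆ S, F.Finite → (⋂₀ F).Infinite

theorem hasStrongFIP_image [Infinite α] {ι : Type*} [LinearOrder ι] {I : Set ι} {y : ι → Set α}
    (hinf : ∀ v ∈ I, (y v).Infinite) (hanti : ∀ v ∈ I, ∀ u < v, (y v \ y u).Finite) :
    HasStrongFIP (y '' I) := by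
  intro F hF hFfin
  obtain ⟨V, hVI, hV, rfl⟩ := exists_subset_image_finite_and.1 ⟨F, hF, hFfin, rfl⟩
  rcases V.eq_empty_or_nonempty with rfl | hne
  · simpa using infinite_univ
  obtain ⟨v, hv, hmax⟩ := hV.exists_maximal hne
  refine infinite_sInter_of_finite_sdiff (hinf v (hVI hv)) hFfin ?_
  rintro _ ⟨u, hu, rfl⟩
  rcases lt_or_ge u v with huv | hvu
  · exact hanti v (hVI hv) u huv
  · rw [le_antisymm (hmax hu hvu) hvu, sdiff_self]
    exact finite_empty

theorem HasStrongFIP.exists_pseudointersection {S : Set (Set α)} (hfip : HasStrongFIP S)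
    (hS : S.Countable) : ∃ P : Set α, P.Infinite ∧ ∀ s ∈ S, (P \ s).Finite := by
  rcases S.eq_empty_or_nonempty with rfl | hne
  · exact ⟨⋂₀ ∅, hfip ∅ subset_rfl finite_empty, by simp⟩
  obtain ⟨s, rfl⟩ := hS.exists_eq_range hne
  have hinter : ∀ n, (⋂₀ (s '' Iic n)).Infinite := fun n =>
    hfip _ (image_subset_range _ _) ((finite_Iic n).image s)
  obtain ⟨g, hgs, hg⟩ := exists_seq_of_forall_finset_exists
    (fun p : ℕ × α => p.2 ∈ ⋂₀ (s '' Iic p.1)) (fun p q => p.1 < q.1 ∧ p.2 ≠ q.2) (by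
      classical
      intro F _
      obtain ⟨y, hy, hyF⟩ := (hinter (F.sup Prod.fst + 1)).exists_notMem_finset (F.image Prod.snd)
      refine ⟨(_, y), hy, fun p hp => ⟨Nat.lt_succ_of_le (Finset.le_sup hp), ?_⟩⟩
      exact fun h => hyF (Finset.mem_image.2 ⟨p, hp, h⟩))
  have hinj : Function.Injective fun n => (g n).2 := .of_lt_imp_ne fun m n hmn =>
    (hg m n hmn).2
  have hmono : StrictMono fun n => (g n).1 := fun m n hmn => (hg m n hmn).1
  refine ⟨range fun n => (g n).2, infinite_range_of_injective hinj, ?_⟩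
  rintro _ ⟨i, rfl⟩
  refine ((finite_Iio i).image fun n => (g n).2).subset ?_
  rintro _ ⟨⟨n, rfl⟩, hn⟩
  refine mem_image_of_mem (fun n => (g n).2) (mem_Iio.2 (not_le.1 fun hin => hn ?_))
  exact hgs n _ (mem_image_of_mem s (hin.trans hmono.le_apply))

theorem exists_pairwise_disjoint_infinite_subsets {P : Set α} (hP : P.Infinite) :
    ∃ q : ℕ → Set α, (∀ n, q n ⊆ P ∧ (q n).Infinite) ∧ Pairwise (Disjoint on q) := by
  obtain ⟨g, hg, hgP⟩ : ∃ g : ℕ → α, Function.Injective g ∧ ∀ n, g n ∈ P :=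
    ⟨fun n => hP.natEmbedding P n, Subtype.val_injective.comp (hP.natEmbedding P).injective,
      fun n => (hP.natEmbedding P n).2⟩
  refine ⟨fun n => range fun k => g (Nat.pair n k), fun n => ⟨?_, ?_⟩, fun m n hmn => ?_⟩
  · exact range_subset_iff.2 fun k => hgP _
  · exact infinite_range_of_injective fun k l h => (Nat.pair_eq_pair.1 (hg h)).2
  · refine Set.disjoint_left.2 ?_
    rintro _ ⟨k, rfl⟩ ⟨l, h⟩
    exact hmn (Nat.pair_eq_pair.1 (hg h)).1.symm

/-- The sets `q n` are immediate successors, in a tree of sets with property `P`, of a branch along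
which the sets in `S` have been chosen. -/
structure IsSplitting (P : Set α → Prop) (S : Set (Set α)) (q : ℕ → Set α) : Prop where
  infinite : ∀ n, (q n).Infinite
  prop : ∀ n, P (q n)
  finite_sdiff : ∀ n, ∀ s ∈ S, (q n \ s).Finite
  disjoint : Pairwise (Disjoint on q)

theorem HasStrongFIP.exists_isSplitting {S : Set (Set α)} (hfip : HasStrongFIP S)
    (hS : S.Countable) {P : Set α → Prop}
    (hP : ∀ X : Set α, X.Infinite → ∃ Y ⊆ X, Y.Infinite ∧ P Y) : ∃ q, IsSplitting P S q := by
  obtain ⟨X, hX, hXS⟩ := hfip.exists_pseudointersection hS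
  obtain ⟨p, hp, hpd⟩ := exists_pairwise_disjoint_infinite_subsets hX
  choose q hqp hq hqP using fun n => hP (p n) (hp n).2
  exact ⟨q, hq, hqP,
    fun n s hs => (hXS s hs).subset (sdiff_subset_sdiff_left ((hqp n).trans (hp n).1)),
    fun m n hmn => (hpd hmn).mono (hqp m) (hqp n)⟩

end Splitting

section TreeOfSets

variable {W α : Type*} [LinearOrder W]

/-- An assignment of infinite sets to the nodes of the tree of functions from closed initial
segments of `W` to `ℕ`: the node `f` restricted to `[0, w]` carries the set `x f w`, which has the
property `P w`. The sets decrease modulo finite sets along the tree and are almost disjoint at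
incompatible nodes. -/
structure IsTreeOfSets (P : W → Set α → Prop) (x : (W → ℕ) → W → Set α) : Prop where
  infinite : ∀ f w, (x f w).Infinite
  prop : ∀ f w, P w (x f w)
  congr : ∀ f g w, (∀ v ≤ w, f v = g v) → x f w = x g w
  finite_sdiff : ∀ f v w, v ≤ w → (x f w \ x f v).Finite
  finite_inter : ∀ f g w, f w ≠ g w → (x f w ∩ x g w).Finite

section Recursion

/-- The tree of sets generated by `q`, where `q w S` lists the sets at the successors at level `w`
of a branch whose earlier nodes carry the sets in `S`. -/
def nodeSet [WellFoundedLT W] (q : W → Set (Set α) → ℕ → Set α) (f : W → ℕ) (w : W) : Set α :=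
  q w (range fun v : Iio w => nodeSet q f v) (f w)
termination_by wellFounded_lt.wrap w
decreasing_by exact v.2

variable [WellFoundedLT W] {q : W → Set (Set α) → ℕ → Set α} {P : W → Set α → Prop}

theorem nodeSet_eq (f : W → ℕ) (w : W) : nodeSet q f w = q w (nodeSet q f '' Iio w) (f w) := by
  rw [nodeSet, image_eq_range]

theorem nodeSet_image_Iio_congr {f g : W → ℕ} {w : W} (h : ∀ v < w, f v = g v) :
    nodeSet q f '' Iio w = nodeSet q g '' Iio w := by
  induction w using WellFoundedLT.induction with
  | ind w ih =>
    refine image_congr fun v hv => ?_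
    rw [nodeSet_eq f v, nodeSet_eq g v, ih v hv fun u hu => h u (hu.trans hv), h v hv]

theorem isSplitting_nodeSet [Infinite α] (hW : ∀ w : W, (Iio w).Countable)
    (hq : ∀ w S, HasStrongFIP S → S.Countable → IsSplitting (P w) S (q w S)) (f : W → ℕ) (w : W) :
    IsSplitting (P w) (nodeSet q f '' Iio w) (q w (nodeSet q f '' Iio w)) := by
  induction w using WellFoundedLT.induction with
  | ind w ih =>
    refine hq w _ (hasStrongFIP_image (fun v hv => ?_) fun v hv u huv => ?_) ((hW w).image _)
    · rw [nodeSet_eq]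
      exact (ih v hv).infinite _
    · rw [nodeSet_eq f v]
      exact (ih v hv).finite_sdiff _ _ (mem_image_of_mem _ huv)

theorem isTreeOfSets_nodeSet [Infinite α] (hW : ∀ w : W, (Iio w).Countable)
    (hq : ∀ w S, HasStrongFIP S → S.Countable → IsSplitting (P w) S (q w S)) :
    IsTreeOfSets P (nodeSet q) := by
  have hsplit := isSplitting_nodeSet hW hq
  have finite_sdiff : ∀ f v w, v ≤ w → (nodeSet q f w \ nodeSet q f v).Finite := by
    intro f v w hvw
    rcases hvw.eq_or_lt with rfl | hvw
    · simp
    · rw [nodeSet_eq f w]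
      exact (hsplit f w).finite_sdiff _ _ (mem_image_of_mem _ hvw)
  refine ⟨fun f w => ?_, fun f w => ?_, fun f g w h => ?_, finite_sdiff, fun f g w hfg => ?_⟩
  · rw [nodeSet_eq]
    exact (hsplit f w).infinite _
  · rw [nodeSet_eq]
    exact (hsplit f w).prop _
  · rw [nodeSet_eq f, nodeSet_eq g, nodeSet_image_Iio_congr fun v hv => h v hv.le, h w le_rfl]
  · obtain ⟨v, hvw, hv, hmin⟩ := exists_minimal_le_of_wellFoundedLT (fun v => f v ≠ g v) w hfg
    have hbelow : ∀ u < v, f u = g u := fun u huv =>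
      by_contra fun hne => (hmin hne huv.le).not_gt huv
    have hdisj : Disjoint (nodeSet q f v) (nodeSet q g v) := by
      rw [nodeSet_eq f, nodeSet_eq g, ← nodeSet_image_Iio_congr hbelow]
      exact (hsplit f v).disjoint hv
    refine finite_inter_of_finite_sdiff (finite_sdiff f v w hvw) (finite_sdiff g v w hvw) ?_
    rw [hdisj.inter_eq]
    exact finite_empty

theorem exists_isTreeOfSets [Infinite α] (hW : ∀ w : W, (Iio w).Countable)
    (hP : ∀ w X, X.Infinite → ∃ Y ⊆ X, Y.Infinite ∧ P w Y) :
    ∃ x : (W → ℕ) → W → Set α, IsTreeOfSets P x := by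
  choose! q hq using fun w (S : Set (Set α)) (hfip : HasStrongFIP S) (hS : S.Countable) =>
    hfip.exists_isSplitting hS (hP w)
  exact ⟨nodeSet q, isTreeOfSets_nodeSet hW hq⟩

end Recursion

namespace IsTreeOfSets

variable {e : W → W → ℕ} {P : W → Set α → Prop} {x : (W → ℕ) → W → Set α}

theorem countable_level (hx : IsTreeOfSets P x) (he : IsCoherentSequence e)
    (hW : ∀ w : W, (Iio w).Countable) (w : W) : ((fun i => x (e i) w) '' Ici w).Countable := by
  let extend : (Iic w → ℕ) → W → ℕ := fun f => Function.extend Subtype.val f 0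
  refine ((he.countable_restrict hW w).image fun f => x (extend f) w).mono ?_
  rintro _ ⟨i, hi, rfl⟩
  refine ⟨_, mem_image_of_mem _ hi, hx.congr _ _ _ fun v hv => ?_⟩
  exact Subtype.val_injective.extend_apply _ _ (⟨v, hv⟩ : Iic w)

theorem finite_inter_of_ne (hx : IsTreeOfSets P x) (he : IsCoherentSequence e) {i j : W}
    (hij : i ≠ j) : (x (e i) i ∩ x (e j) j).Finite := by
  wlog h : i < j generalizing i j
  · rw [inter_comm]
    exact this hij.symm (hij.lt_or_gt.resolve_left h)
  have hincompatible : e i i ≠ e j i := by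
    rw [he.self]
    exact (he.pos j i h).ne
  exact finite_inter_of_finite_sdiff (by simp) (hx.finite_sdiff _ _ _ h.le)
    (hx.finite_inter _ _ _ hincompatible)

theorem injective (hx : IsTreeOfSets P x) (he : IsCoherentSequence e) :
    Function.Injective fun i => x (e i) i := by
  intro i j (hij : x (e i) i = x (e j) j)
  by_contra hne
  have h := hx.finite_inter_of_ne he hne
  rw [← hij, inter_self] at h
  exact hx.infinite _ _ h

theorem isAlmostDisjointFamily_range (hx : IsTreeOfSets P x) (he : IsCoherentSequence e) :
    IsAlmostDisjointFamily (range fun i => x (e i) i) := by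
  constructor
  · rintro _ ⟨i, rfl⟩
    exact hx.infinite _ _
  · rintro _ ⟨i, rfl⟩ _ ⟨j, rfl⟩ hij
    exact hx.finite_inter_of_ne he fun h => hij (h ▸ rfl)

theorem isAntiLuzin_range [Countable α] (hx : IsTreeOfSets P x)
    (he : IsCoherentSequence e) (hW : ∀ w : W, (Iio w).Countable) :
    IsAntiLuzin (range fun i => x (e i) i) := by
  refine isAntiLuzin_range_of_injective (hx.injective he) fun J hJ => ?_
  obtain ⟨w, m, n, hmn, hm, hn⟩ := he.exists_splitting_level hW hJ
  have hcone : ∀ l, ¬ {k ∈ J ∩ Ici w | e k w = l}.Countable →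
      ∃ i, e i w = l ∧ ∃ K ⊆ J, ¬ K.Countable ∧ ((⋃ k ∈ K, x (e k) k) \ x (e i) w).Finite := by
    intro l hl
    obtain ⟨i, hi, K, hKJ, hK, hfin⟩ := exists_uncountable_subset_iUnion_finite_sdiff hl
      ((hx.countable_level he hW w).mono (image_mono fun k hk => hk.1.2))
      fun k hk => hx.finite_sdiff (e k) w k hk.1.2
    exact ⟨i, hi.2, K, hKJ.trans fun k hk => hk.1.1, hK, hfin⟩
  obtain ⟨i, rfl, K, hKJ, hK, hKi⟩ := hcone m hm
  obtain ⟨j, rfl, L, hLJ, hL, hLj⟩ := hcone n hn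
  exact ⟨K, hKJ, L, hLJ, hK, hL,
    finite_inter_of_finite_sdiff hKi hLj (hx.finite_inter _ _ _ hmn)⟩

end IsTreeOfSets

end TreeOfSets

section HiddenWeakTreeFamily

variable {α : Type*} {T : Set α} {r : α → α → Prop}

/-- `X` either misses `T`, or is a chain or an antichain contained in `T`. A branch of a tree order
on `T` can then have infinite intersection with `X` only if `X` is a chain. -/
def IsHomogeneousFor (T : Set α) (r : α → α → Prop) (X : Set α) : Prop :=
  Disjoint X T ∨ X ⊆ T ∧ (IsChain r X ∨ IsAntichain r X)

theorem exists_infinite_isChain_or_isAntichain [IsTrans α r] {X : Set α} (hX : X.Infinite) :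
    ∃ Y ⊆ X, Y.Infinite ∧ (IsChain r Y ∨ IsAntichain r Y) := by
  let f : ℕ → α := fun n => hX.natEmbedding X n
  suffices ∃ g : ℕ ↪o ℕ, IsChain r (range (f ∘ g)) ∨ IsAntichain r (range (f ∘ g)) by
    obtain ⟨g, hg⟩ := this
    exact ⟨range (f ∘ g), range_subset_iff.2 fun n => (hX.natEmbedding X (g n)).2,
      infinite_range_of_injective (Subtype.val_injective.comp
        ((hX.natEmbedding X).injective.comp g.injective)), hg⟩
  obtain ⟨g, hinc | hninc⟩ := exists_increasing_or_nonincreasing_subseq r f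
  · exact ⟨g, Or.inl ((Std.Symm.pairwise_on (r := Relation.SymmGen r) _).2
      fun m n hmn => Or.inl (hinc m n hmn)).range_pairwise⟩
  obtain ⟨g', hdec | hndec⟩ := exists_increasing_or_nonincreasing_subseq (Function.swap r) (f ∘ g)
  · exact ⟨g'.trans g, Or.inl ((Std.Symm.pairwise_on (r := Relation.SymmGen r) _).2
      fun m n hmn => Or.inr (hdec m n hmn)).range_pairwise⟩
  · have hincomp : (range (f ∘ g'.trans g)).Pairwise (IncompRel r) :=
      ((Std.Symm.pairwise_on _).2 fun m n hmn =>
        ⟨hninc _ _ (g'.lt_iff_lt.2 hmn), hndec m n hmn⟩).range_pairwise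
    exact ⟨g'.trans g, Or.inr (hincomp.imp fun _ _ h => h.1)⟩

theorem IsTreeOrder.exists_isHomogeneousFor (hT : IsTreeOrder T r) {X : Set α} (hX : X.Infinite) :
    ∃ Y ⊆ X, Y.Infinite ∧ IsHomogeneousFor T r Y := by
  by_cases hXT : (X ∩ T).Infinite
  · let s : α → α → Prop := fun y z => y ∈ T ∧ z ∈ T ∧ r y z
    have : IsTrans α s :=
      ⟨fun a b c hab hbc => ⟨hab.1, hbc.2.1, hT.trans a hab.1 b hab.2.1 c hbc.2.1 hab.2.2 hbc.2.2⟩⟩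
    obtain ⟨Y, hYX, hY, hYs⟩ := exists_infinite_isChain_or_isAntichain (r := s) hXT
    have hYT : Y ⊆ T := fun y hy => (hYX hy).2
    refine ⟨Y, fun y hy => (hYX hy).1, hY, Or.inr ⟨hYT, hYs.imp (fun h => ?_) fun h => ?_⟩⟩
    · exact h.mono_rel fun _ _ hyz => hyz.2.2
    · exact fun y hy z hz hyz hr => h hy hz hyz ⟨hYT hy, hYT hz, hr⟩
  · refine ⟨X \ T, sdiff_subset, fun h => hX ?_, Or.inl disjoint_sdiff_left⟩
    rw [← inter_union_sdiff X T]
    exact (not_infinite.1 hXT).union h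

theorem exists_subset_isHomogeneousFor (T : Set α) (r : α → α → Prop) {X : Set α}
    (hX : X.Infinite) :
    ∃ Y ⊆ X, Y.Infinite ∧ (IsTreeOrder T r → IsHomogeneousFor T r Y) := by
  by_cases hT : IsTreeOrder T r
  · obtain ⟨Y, hYX, hY, hhom⟩ := hT.exists_isHomogeneousFor hX
    exact ⟨Y, hYX, hY, fun _ => hhom⟩
  · exact ⟨X, subset_rfl, hX, fun h => absurd h hT⟩

theorem IsTreeBranch.mem_of_rel (hT : IsTreeOrder T r) {b : Set α} (hb : IsTreeBranch T r b)
    {y z : α} (hy : y ∈ b) (hz : z ∈ T) (h : r z y) : z ∈ b := by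
  have hyT := hb.1.1 hy
  refine hb.2 (y := insert z b) ⟨insert_subset hz hb.1.1, hb.1.2.insert fun v hv hzv => ?_⟩
    (subset_insert z b) (mem_insert z b)
  have hvT := hb.1.1 hv
  by_cases hvy : v = y
  · exact Or.inl (hvy ▸ h)
  rcases hb.1.2 hv hy hvy with hr | hr
  · rcases hT.pred_total y hyT z hz v hvT h hr with hzv' | hzv' | hzv'
    · exact Or.inl hzv'
    · exact absurd hzv' hzv
    · exact Or.inr hzv'
  · exact Or.inl (hT.trans z hz y hyT v hvT h hr)

theorem IsTreeBranch.infinite_inter (hT : IsTreeOrder T r) {b c X : Set α}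
    (hb : IsTreeBranch T r b) (hc : IsTreeBranch T r c) (hXT : X ⊆ T) (hX : IsChain r X)
    (hbX : (b ∩ X).Infinite) (hcX : (c ∩ X).Infinite) : (b ∩ c).Infinite := by
  by_cases h : b ∩ X ⊆ c
  · exact hbX.mono fun y hy => ⟨hy.1, h hy⟩
  obtain ⟨y, hy, hyc⟩ := not_subset.1 h
  -- All of `c ∩ X` lies below `y`, since `c` is closed downwards and omits `y`.
  refine hcX.mono fun z hz => ⟨?_, hz.1⟩
  rcases hX hz.2 hy.2 fun hzy => hyc (hzy ▸ hz.1) with hzy | hyz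
  · exact hb.mem_of_rel hT hy.1 (hXT hz.2) hzy
  · exact absurd (hc.mem_of_rel hT hz.1 (hXT hy.2) hyz) hyc

theorem IsHomogeneousFor.isChain {X b : Set α} (hX : IsHomogeneousFor T r X)
    (hb : IsTreeBranch T r b) (hbX : (b ∩ X).Infinite) : X ⊆ T ∧ IsChain r X := by
  rcases hX with hdisj | ⟨hXT, hchain | hanti⟩
  · exact absurd finite_empty ((hdisj.mono_right hb.1.1).symm.inter_eq ▸ hbX)
  · exact ⟨hXT, hchain⟩
  · exact absurd (inter_subsingleton_of_isChain_of_isAntichain hb.1.2 hanti).finite hbX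

theorem IsWeakTreeFamily.exists_isTreeOrder {A : Set (Set α)} (hA : IsWeakTreeFamily A) :
    ∃ r, IsTreeOrder (⋃₀ A) r ∧
      ∀ X, IsHomogeneousFor (⋃₀ A) r X → {a ∈ A | (a \ X).Finite}.Subsingleton := by
  obtain ⟨-, hAD, r, hr, φ, hbranch, hinj, hφ, hsub⟩ := hA
  refine ⟨r, hr, fun X hX a ⟨ha, haX⟩ b ⟨hb, hbX⟩ => hinj ha hb ?_⟩
  have hφaX := infinite_inter_of_finite_sdiff (hAD.1 a ha) (hsub a ha) haX
  have hφbX := infinite_inter_of_finite_sdiff (hAD.1 b hb) (hsub b hb) hbX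
  obtain ⟨hXT, hchain⟩ := hX.isChain (hbranch a ha) hφaX
  exact hφ.eq (mem_image_of_mem φ ha) (mem_image_of_mem φ hb)
    ((hbranch a ha).infinite_inter hr (hbranch b hb) hXT hchain hφaX hφbX)

theorem IsHiddenWeakTreeFamily.exists_isTreeOrder {B : Set (Set α)}
    (hB : IsHiddenWeakTreeFamily B) (hAD : IsAlmostDisjointFamily B) :
    ∃ T r, IsTreeOrder T r ∧
      ∀ X, IsHomogeneousFor T r X → {b ∈ B | (b \ X).Finite}.Subsingleton := by
  obtain ⟨T, hT⟩ := hB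
  obtain ⟨r, hr, hsub⟩ := hT.exists_isTreeOrder
  refine ⟨_, r, hr, fun X hX b ⟨hb, hbX⟩ c ⟨hc, hcX⟩ => hAD.2.eq hb hc fun hfin => ?_⟩
  have htrace : b ∩ T = c ∩ T := hsub X hX
    ⟨mem_image_of_mem _ hb, hbX.subset (sdiff_subset_sdiff_left inter_subset_left)⟩
    ⟨mem_image_of_mem _ hc, hcX.subset (sdiff_subset_sdiff_left inter_subset_left)⟩
  exact hT.2.1.1 _ (mem_image_of_mem _ hb) (hfin.subset
    (subset_inter inter_subset_left (htrace.trans_subset inter_subset_left)))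

theorem IsAlmostDisjointFamily.not_isHiddenWeakTreeFamily {B : Set (Set α)}
    (hB : IsAlmostDisjointFamily B)
    (hcover : ∀ T r, IsTreeOrder T r → ∃ 𝒳 : Set (Set α), 𝒳.Countable ∧
      (∀ X ∈ 𝒳, IsHomogeneousFor T r X) ∧ {b ∈ B | ∀ X ∈ 𝒳, (b \ X).Infinite}.Countable) :
    ¬ IsHiddenWeakTreeFamily B := by
  intro hhidden
  obtain ⟨T, r, hr, hsub⟩ := hhidden.exists_isTreeOrder hB
  obtain ⟨𝒳, h𝒳, hhom, hrest⟩ := hcover T r hr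
  have hcount : B.Countable := by
    refine (hrest.union (h𝒳.biUnion fun X hX => (hsub X (hhom X hX)).countable)).mono fun b hb => ?_
    by_cases h : ∀ X ∈ 𝒳, (b \ X).Infinite
    · exact Or.inl ⟨hb, h⟩
    · push Not at h
      obtain ⟨X, hX, hbX⟩ := h
      exact Or.inr (mem_iUnion₂.2 ⟨X, hX, hb, hbX⟩)
  obtain ⟨T', hT'⟩ := hhidden
  exact hT'.1 (hcount.image _)

theorem IsTreeOfSets.not_isHiddenWeakTreeFamily {W : Type*} [LinearOrder W] {e : W → W → ℕ}
    {P : W → Set α → Prop} {x : (W → ℕ) → W → Set α} (hx : IsTreeOfSets P x)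
    (he : IsCoherentSequence e) (hW : ∀ w : W, (Iio w).Countable)
    (hP : ∀ T r, IsTreeOrder T r → ∃ w, ∀ X, P w X → IsHomogeneousFor T r X)
    {B : Set (Set α)} (hB : B ⊆ range fun i => x (e i) i) : ¬ IsHiddenWeakTreeFamily B := by
  have hAD := hx.isAlmostDisjointFamily_range he
  refine IsAlmostDisjointFamily.not_isHiddenWeakTreeFamily
    ⟨fun b hb => hAD.1 b (hB hb), hAD.2.mono hB⟩ fun T r hr => ?_
  obtain ⟨w, hw⟩ := hP T r hr
  refine ⟨_, hx.countable_level he hW w, ?_, ((hW w).image fun i => x (e i) i).mono ?_⟩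
  · rintro _ ⟨i, -, rfl⟩
    exact hw _ (hx.prop _ _)
  · rintro b ⟨hb, hinf⟩
    obtain ⟨i, rfl⟩ := hB hb
    refine mem_image_of_mem _ (not_le.1 fun hwi => ?_)
    exact hinf _ (mem_image_of_mem _ hwi) (hx.finite_sdiff _ _ _ hwi)

end HiddenWeakTreeFamily

end Construction

theorem theorem4p6_general (CH : (𝔠 : Cardinal.{0}) = ℵ₁) :
    ∃ A : Set (Set ℕ), ¬ A.Countable ∧ IsAlmostDisjointFamily A ∧ IsAntiLuzin A ∧
      ∀ B ⊆ A, ¬ IsHiddenWeakTreeFamily B := by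
  let W := (ℵ₁ : Cardinal.{0}).ord.ToType
  have hcard : #W = ℵ₁ := Cardinal.mk_ord_toType _
  have hW : ∀ w : W, (Set.Iio w).Countable := fun w =>
    Cardinal.le_aleph0_iff_set_countable.1 (Cardinal.lt_aleph_one_iff.1 (by
      simpa [hcard] using Cardinal.mk_Iio_lt w (by simp [W])))
  have : Uncountable W := by
    rw [← Cardinal.aleph0_lt_mk_iff, hcard]
    exact Cardinal.aleph0_lt_aleph_one
  obtain ⟨order⟩ : Nonempty (W ≃ Set ℕ × (ℕ → ℕ → Prop)) := by
    rw [← Cardinal.eq, hcard, ← CH]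
    simp [Cardinal.mk_set]
  obtain ⟨e, he⟩ := exists_isCoherentSequence hW
  obtain ⟨x, hx⟩ := exists_isTreeOfSets (α := ℕ) hW fun w X hX =>
    exists_subset_isHomogeneousFor (order w).1 (order w).2 hX
  refine ⟨Set.range fun i => x (e i) i, fun h => ?_, hx.isAlmostDisjointFamily_range he,
    hx.isAntiLuzin_range he hW, fun B hB => hx.not_isHiddenWeakTreeFamily he hW ?_ hB⟩
  · exact Set.not_countable_univ
      ((Set.mapsTo_range _ Set.univ).countable_of_injOn (hx.injective he).injOn h)
  · intro T r hr
    refine ⟨order.symm (T, r), fun X hX => ?_⟩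
    rw [order.apply_symm_apply] at hX
    exact hX hr

theorem theorem4p6 (CH : (𝔠 : Cardinal.{0}) = ℵ₁)
    {L : Type*} [LinearOrder L] [TopologicalSpace L] [OrderTopology L] (hL : IsSuslinLine L) :
    ∃ A : Set (Set ℕ), ¬ A.Countable ∧ IsAlmostDisjointFamily A ∧ IsAntiLuzin A ∧
      ∀ B ⊆ A, ¬ B.Countable → ¬ IsHiddenWeakTreeFamily B := by
  obtain ⟨A, hA, hAD, hluzin, hhidden⟩ := theorem4p6_general CH
  exact ⟨A, hA, hAD, hluzin, fun B hB _ => hhidden B hB⟩
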